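/- \textbf{Theorem (Conditional Bipolar Theorem).} Let $(\Omega,\mathcal F,\mathbb P)$ be a probability space and $\mathcal G\subseteq\mathcal F$ a sub-$\sigma$-algebra. Let $L^0_+(\mathcal F)$ be the set of ($\mathbb P$-a.s. equivalence classes of) real-valued nonnegative $\mathcal F$-measurable random variables, and $L^0_+(\mathcal G)$ the subset of those that have a $\mathcal G$-measurable representative. For $\mathcal C\subseteq L^0_+(\mathcal F)$ define the conditional polar $$[\mathcal C|\mathcal G]^{\circ}=\{g\in L^0_+(\mathcal F)\,:\,\mathbb E[fg|\mathcal G]\le 1\text{ a.s. for all }f\in\mathcal C\},$$ where conditional expectations of nonnegative random variables take values in $[0,\infty]$, and the conditional bipolar $[\mathcal C|\mathcal G]^{\circ\circ}=\big[\,[\mathcal C|\mathcal G]^{\circ}\,\big|\,\mathcal G\big]^{\circ}$. A set $\mathcal D\subseteq L^0_+(\mathcal F)$ is called \begin{itemize} \item $\mathcal G$-convex if $hf+(1-h)g\in\mathcal D$ for all $f,g\in\mathcal D$ and all $h\in L^0_+(\mathcal G)$ with $h\le 1$ a.s.; \item solid if $f\in\mathcal D$, $g\in L^0_+(\mathcal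 F)$ and $g\le f$ a.s. imply $g\in\mathcal D$; \item closed if it is closed in the topology of convergence in probability; \item bounded in probability if for every $\varepsilon>0$ there is $M>0$ such that $\mathbb P[f>M]<\varepsilon$ for all $f\in\mathcal D$. \end{itemize} Let $\mathcal C\subseteq L^0_+(\mathcal F)$ be nonempty and bounded in probability. Then $[\mathcal C|\mathcal G]^{\circ\circ}$ is the smallest $\mathcal G$-convex, solid and closed subset of $L^0_+(\mathcal F)$ containing $\mathcal C$; that is, it is $\mathcal G$-convex, solid, closed and contains $\mathcal C$, and it is contained in every $\mathcal G$-convex, solid and closed subset of $L^0_+(\mathcal F)$ that contains $\mathcal C$. -/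

import Mathlib

open MeasureTheory Filter Topology
open scoped ENNReal

noncomputable section

namespace CondBipolar

variable {Ω : Type*}

/-- `L⁰₊(F)`: the nonnegative elements of the space `Ω →ₘ[P] ℝ` of `P`-a.e. equivalence classes of
real-valued random variables. -/
def L0plus [MeasurableSpace Ω] (P : Measure Ω) : Set (Ω →ₘ[P] ℝ) :=
  {f | 0 ≤ f}

/-- `L⁰₊(G)`: the elements of `L⁰₊(F)` that have a `G`-measurable representative. -/
def L0plusSub (G : MeasurableSpace Ω) [MeasurableSpace Ω] (P : Measure Ω) : Set (Ω →ₘ[P] ℝ) :=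
  {f | f ∈ L0plus P ∧ AEStronglyMeasurable[G] f P}

/-- The topology of convergence in probability on `L⁰(F)`: a set is open iff with each `f` it
contains, for some `ε > 0`, every `g` such that `P(|g - f| ≥ ε) < ε`. -/
@[reducible] def probTopology [MeasurableSpace Ω] (P : Measure Ω) : TopologicalSpace (Ω →ₘ[P] ℝ) where
  IsOpen U := ∀ f ∈ U, ∃ ε : ℝ, 0 < ε ∧
    ∀ g : Ω →ₘ[P] ℝ, P {ω | ε ≤ |g ω - f ω|} < ENNReal.ofReal ε → g ∈ U
  isOpen_univ := fun _ _ => ⟨1, one_pos, fun _ _ => trivial⟩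
  isOpen_inter := by
    rintro U V hU hV f ⟨hfU, hfV⟩
    obtain ⟨a, ha, hUa⟩ := hU f hfU
    obtain ⟨b, hb, hVb⟩ := hV f hfV
    refine ⟨min a b, lt_min ha hb, fun g hg => ⟨hUa g ?_, hVb g ?_⟩⟩
    · refine lt_of_le_of_lt (measure_mono fun ω hω => ?_)
        (hg.trans_le (ENNReal.ofReal_le_ofReal (min_le_left a b)))
      exact (min_le_left a b).trans hω
    · refine lt_of_le_of_lt (measure_mono fun ω hω => ?_)
        (hg.trans_le (ENNReal.ofReal_le_ofReal (min_le_right a b)))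
      exact (min_le_right a b).trans hω
  isOpen_sUnion := by
    rintro S hS f ⟨U, hU, hf⟩
    obtain ⟨ε, hε, h⟩ := hS U hU f hf
    exact ⟨ε, hε, fun g hg => ⟨U, hU, h g hg⟩⟩

/-- `C` is closed with respect to the topology of convergence in probability. -/
def IsClosedInProb [MeasurableSpace Ω] (P : Measure Ω) (C : Set (Ω →ₘ[P] ℝ)) : Prop :=
  IsClosed[probTopology P] C

/-- Closedness in probability agrees with closedness under limits of sequences that converge
in measure. -/
theorem isClosedInProb_iff_seq [MeasurableSpace Ω] (P : Measure Ω) (C : Set (Ω →ₘ[P] ℝ)) :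
    IsClosedInProb P C ↔ ∀ (u : ℕ → Ω →ₘ[P] ℝ) (f : Ω →ₘ[P] ℝ), (∀ n, u n ∈ C) →
      TendstoInMeasure P (fun n => (u n : Ω → ℝ)) atTop f → f ∈ C := by
  have key : IsClosedInProb P C ↔ ∀ f ∈ Cᶜ, ∃ ε : ℝ, 0 < ε ∧
      ∀ g : Ω →ₘ[P] ℝ, P {ω | ε ≤ |g ω - f ω|} < ENNReal.ofReal ε → g ∈ Cᶜ := by
    unfold IsClosedInProb
    rw [← @isOpen_compl_iff _ _ (probTopology P)]
    rfl
  rw [key]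
  constructor
  · intro h u f hu hlim
    by_contra hf
    obtain ⟨ε, hε, hball⟩ := h f hf
    rw [tendstoInMeasure_iff_norm] at hlim
    have h1 := (hlim ε hε).eventually_lt_const (ENNReal.ofReal_pos.2 hε)
    obtain ⟨n, hn⟩ := h1.exists
    exact hball (u n) hn (hu n)
  · intro h f hf
    by_contra hcon
    push Not at hcon
    have hpos : ∀ n : ℕ, (0 : ℝ) < 1 / ((n : ℝ) + 1) := fun n => Nat.one_div_pos_of_nat
    choose u hu1 hu2 using fun n : ℕ => hcon (1 / ((n : ℝ) + 1)) (hpos n)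
    refine hf (h u f (fun n => not_not.1 (hu2 n)) ?_)
    rw [tendstoInMeasure_iff_norm]
    intro ε hε
    have hlim : Tendsto (fun n : ℕ => ENNReal.ofReal (1 / ((n : ℝ) + 1))) atTop (𝓝 0) := by
      simpa using ENNReal.tendsto_ofReal tendsto_one_div_add_atTop_nhds_zero_nat
    refine tendsto_of_tendsto_of_tendsto_of_le_of_le' tendsto_const_nhds hlim
      (Eventually.of_forall fun _ => zero_le) ?_
    filter_upwards [tendsto_one_div_add_atTop_nhds_zero_nat.eventually_lt_const hε] with n hn
    refine (measure_mono fun ω hω => ?_).trans (hu1 n).le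
    exact hn.le.trans hω

/-- `C` is solid: it contains every `g ∈ L⁰₊(F)` dominated a.s. by an element of `C`. -/
def IsSolidSet [MeasurableSpace Ω] (P : Measure Ω) (C : Set (Ω →ₘ[P] ℝ)) : Prop :=
  ∀ f ∈ C, ∀ g ∈ L0plus P, g ≤ f → g ∈ C

/-- `C` is `G`-convex. -/
def IsCondConvex (G : MeasurableSpace Ω) [MeasurableSpace Ω] (P : Measure Ω)
    (C : Set (Ω →ₘ[P] ℝ)) : Prop :=
  ∀ f ∈ C, ∀ g ∈ C, ∀ h ∈ L0plusSub G P, h ≤ 1 → h * f + (1 - h) * g ∈ C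

/-- `C` is bounded in probability. -/
def IsBoundedInProb [MeasurableSpace Ω] (P : Measure Ω) (C : Set (Ω →ₘ[P] ℝ)) : Prop :=
  ∀ ε : ℝ, 0 < ε → ∃ M : ℝ, 0 < M ∧ ∀ f ∈ C, P {ω | M < f ω} < ENNReal.ofReal ε

/-- The conditional polar of `C` with respect to `G`: all `g ∈ L⁰₊(F)` with `E[f g | G] ≤ 1` a.s.
for every `f ∈ C`, where the conditional expectation of a nonnegative random variable takes values
in `[0, ∞]`. -/
def condPolar (G : MeasurableSpace Ω) [MeasurableSpace Ω] (P : Measure Ω)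
    (C : Set (Ω →ₘ[P] ℝ)) : Set (Ω →ₘ[P] ℝ) :=
  {g | g ∈ L0plus P ∧
    ∀ f ∈ C, ∀ᵐ ω ∂P, condLExp G P (fun ω' => ENNReal.ofReal (f ω' * g ω')) ω ≤ 1}

/-- The conditional bipolar of `C` with respect to `G`. -/
def condBipolar (G : MeasurableSpace Ω) [MeasurableSpace Ω] (P : Measure Ω)
    (C : Set (Ω →ₘ[P] ℝ)) : Set (Ω →ₘ[P] ℝ) :=
  condPolar G P (condPolar G P C)

end CondBipolar

end

/-!
Every conditional polar is `G`-convex (by the pull-out property `condLExp_mul_left`), solid, and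
closed in probability (by Fatou's lemma), and the bipolar contains `C`. Since `C ⊆ D` implies
`C°° ⊆ D°°`, minimality amounts to `D°° ⊆ D` for every nonempty `G`-convex, solid and closed set `D`
(`condBipolar_subset`); this does not depend on any boundedness of `C` or `D`.

Let `f₀ ∉ D` be nonnegative. A truncation of `f₀` lies outside `D`, and the square integrable
elements of `D` form a closed convex subset of `L²`, so the Hahn–Banach theorem gives a separating
functional on `L²`. Solidity allows replacing its density by the positive part `g`, and the
truncations `f ∧ n ∈ D ∩ L²` of `f ∈ D` extend the bound to `D`: there is `α` with
`E[f g] ≤ α < E[f₀ g]` for all `f ∈ D` (`exists_separating_density`).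

To localize, let `X` be the essential supremum of `E[f g | G]` over `f ∈ D`. By `G`-convexity,
elements of `D` can be pasted along `G`-measurable sets (`exists_condLExp_ge`), so this family is
directed upward and `E[X] ≤ α` (`exists_seq_iSup_ae_upper_bound`). For `0 < δ < E[f₀ g] - α` the
function `g / (X + δ)` belongs to the conditional polar of `D`, whereas `E[f₀ g | G] ≤ X + δ` would
give `E[f₀ g] ≤ α + δ`. Hence `f₀` is not in the conditional bipolar of `D`.
-/

namespace CondBipolar

variable {Ω : Type*} {G : MeasurableSpace Ω} [F : MeasurableSpace Ω] {P : Measure Ω}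

/-! ### Conditional expectations of `[0, ∞]`-valued functions -/

theorem lintegral_mul_condLExp (hG : G ≤ F) [IsFiniteMeasure P] {h X : Ω → ℝ≥0∞}
    (hh : Measurable[G] h) (hX : AEMeasurable X P) :
    ∫⁻ ω, h ω * condLExp G P X ω ∂P = ∫⁻ ω, h ω * X ω ∂P := by
  have hE : ∀ u : Ω → ℝ≥0∞, Measurable[F] u → Measurable[F] fun ω => u ω * condLExp G P X ω :=
    fun u hu => hu.mul (measurable_condLExp' _ _ _)
  have hEX : ∀ u : Ω → ℝ≥0∞, Measurable[F] u → AEMeasurable (fun ω => u ω * X ω) P :=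
    fun u hu => hu.aemeasurable.mul hX
  refine Measurable.ennreal_induction (mα := G)
    (motive := fun h => ∫⁻ ω, h ω * condLExp G P X ω ∂P = ∫⁻ ω, h ω * X ω ∂P)
    (fun c s hs => ?_) (fun f g _ hf hg hf' hg' => ?_) (fun f hf hmono ih => ?_) hh
  · have key : ∀ Y : Ω → ℝ≥0∞, AEMeasurable Y P →
        ∫⁻ ω, s.indicator (fun _ => c) ω * Y ω ∂P = c * ∫⁻ ω in s, Y ω ∂P := by
      intro Y hY
      rw [← lintegral_const_mul'' c hY.restrict, ← lintegral_indicator (hG s hs)]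
      exact lintegral_congr fun ω => (Set.indicator_mul_left s (fun _ => c) Y).symm
    rw [key _ (measurable_condLExp' _ _ _).aemeasurable, key _ hX, setLIntegral_condLExp hG P X hs]
  · have hfF : Measurable[F] f := hf.mono hG le_rfl
    simp only [Pi.add_apply, add_mul]
    rw [lintegral_add_left (hE f hfF), lintegral_add_left' (hEX f hfF), hf', hg']
  · have hfF : ∀ n, Measurable[F] (f n) := fun n => (hf n).mono hG le_rfl
    simp only [ENNReal.iSup_mul]
    rw [lintegral_iSup (fun n => hE _ (hfF n)) fun i j hij ω => mul_le_mul_left (hmono hij ω) _,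
      lintegral_iSup' (fun n => hEX _ (hfF n))
        (ae_of_all _ fun ω i j hij => mul_le_mul_left (hmono hij ω) _)]
    exact iSup_congr ih

/-- The pull-out property: `G`-measurable factors can be taken out of `E[· | G]`. -/
theorem condLExp_mul_left (hG : G ≤ F) [IsFiniteMeasure P] {h X : Ω → ℝ≥0∞}
    (hh : Measurable[G] h) (hX : AEMeasurable X P) :
    condLExp G P (fun ω => h ω * X ω) =ᵐ[P] fun ω => h ω * condLExp G P X ω := by
  refine (ae_eq_condLExp hG P _ (hh.mul (measurable_condLExp _ _ _)) fun s hs => ?_).symm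
  have key : ∀ Y : Ω → ℝ≥0∞,
      ∫⁻ ω in s, h ω * Y ω ∂P = ∫⁻ ω, s.indicator h ω * Y ω ∂P := by
    intro Y
    rw [← lintegral_indicator (hG s hs)]
    exact lintegral_congr fun ω => Set.indicator_mul_left s h Y
  change ∫⁻ ω in s, h ω * condLExp G P X ω ∂P = _
  rw [key, key, lintegral_mul_condLExp hG (hh.indicator hs) hX]

theorem condLExp_le_one_iff (hG : G ≤ F) [IsFiniteMeasure P] {X : Ω → ℝ≥0∞} :
    (∀ᵐ ω ∂P, condLExp G P X ω ≤ 1) ↔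
      ∀ s, MeasurableSet[G] s → ∫⁻ ω in s, X ω ∂P ≤ P s := by
  constructor
  · intro h s hs
    rw [← setLIntegral_condLExp hG P X hs, ← setLIntegral_one]
    exact lintegral_mono_ae (ae_restrict_of_ae h)
  · intro h
    refine ae_le_of_ae_le_trim (hm := hG) (f₂ := fun _ => 1)
      (ae_le_of_forall_setLIntegral_le_of_sigmaFinite (measurable_condLExp _ _ _) fun s hs _ => ?_)
    rw [setLIntegral_condLExp_trim hG P X hs, setLIntegral_const, one_mul, trim_measurableSet_eq hG hs]
    exact h s hs

/-! ### Conditional polars -/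

theorem mem_L0plus_iff {f : Ω →ₘ[P] ℝ} : f ∈ L0plus P ↔ ∀ᵐ ω ∂P, 0 ≤ f ω := by
  change 0 ≤ f ↔ _
  rw [← AEEqFun.coeFn_le]
  constructor <;> intro h <;> filter_upwards [h, AEEqFun.coeFn_zero (μ := P) (β := ℝ)] with ω h1 h2
  · rwa [h2] at h1
  · rwa [h2]

theorem aemeasurable_ofReal_mul (f g : Ω →ₘ[P] ℝ) :
    AEMeasurable (fun ω => ENNReal.ofReal (f ω * g ω)) P :=
  (f.measurable.mul g.measurable).ennreal_ofReal.aemeasurable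

theorem coeFn_condConvex_comb (h f g : Ω →ₘ[P] ℝ) :
    ∀ᵐ ω ∂P, (h * f + (1 - h) * g : Ω →ₘ[P] ℝ) ω = h ω * f ω + (1 - h ω) * g ω := by
  filter_upwards [AEEqFun.coeFn_add (h * f) ((1 - h) * g), AEEqFun.coeFn_mul h f,
    AEEqFun.coeFn_mul (1 - h) g, AEEqFun.coeFn_sub 1 h,
    AEEqFun.coeFn_one (μ := P) (β := ℝ)] with ω h1 h2 h3 h4 h5
  simp [h1, h2, h3, h4, h5]

theorem isCondConvex_condPolar (hG : G ≤ F) [IsFiniteMeasure P] {C : Set (Ω →ₘ[P] ℝ)}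
    (hC : C ⊆ L0plus P) : IsCondConvex G P (condPolar G P C) := by
  rintro f ⟨hf, hf'⟩ g ⟨hg, hg'⟩ h ⟨hh, hhG⟩ h1
  have hcomb := coeFn_condConvex_comb h f g
  have hf0 := mem_L0plus_iff.1 hf
  have hg0 := mem_L0plus_iff.1 hg
  have hh0 := mem_L0plus_iff.1 hh
  have hh1 : ∀ᵐ ω ∂P, h ω ≤ 1 := by
    filter_upwards [AEEqFun.coeFn_le.2 h1, AEEqFun.coeFn_one (μ := P) (β := ℝ)] with ω a b
    simpa [b] using a
  refine ⟨mem_L0plus_iff.2 ?_, fun k hk => ?_⟩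
  · filter_upwards [hcomb, hf0, hg0, hh0, hh1] with ω e a b c d
    rw [e]
    exact add_nonneg (mul_nonneg c a) (mul_nonneg (sub_nonneg.2 d) b)
  · have hk0 := mem_L0plus_iff.1 (hC hk)
    have hmk : Measurable[G] (hhG.mk h) := hhG.stronglyMeasurable_mk.measurable
    have hH : Measurable[G] fun ω => ENNReal.ofReal (hhG.mk h ω) := hmk.ennreal_ofReal
    have hH' : Measurable[G] fun ω => ENNReal.ofReal (1 - hhG.mk h ω) :=
      (measurable_const.sub hmk).ennreal_ofReal
    have hXf := aemeasurable_ofReal_mul k f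
    have hXg := aemeasurable_ofReal_mul k g
    have e1 : (fun ω => ENNReal.ofReal (k ω * (h * f + (1 - h) * g : Ω →ₘ[P] ℝ) ω)) =ᵐ[P]
        (fun ω => ENNReal.ofReal (hhG.mk h ω) * ENNReal.ofReal (k ω * f ω)) +
          fun ω => ENNReal.ofReal (1 - hhG.mk h ω) * ENNReal.ofReal (k ω * g ω) := by
      filter_upwards [hcomb, hf0, hg0, hh0, hh1, hk0, hhG.ae_eq_mk] with ω e a b c d k0 m
      rw [Pi.add_apply, e, ← m, ← ENNReal.ofReal_mul c, ← ENNReal.ofReal_mul (sub_nonneg.2 d),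
        ← ENNReal.ofReal_add (mul_nonneg c (mul_nonneg k0 a))
          (mul_nonneg (sub_nonneg.2 d) (mul_nonneg k0 b))]
      congr 1
      ring
    filter_upwards [condLExp_congr_ae (mΩ := G) e1,
      condLExp_add_left (mΩ := G)
        (X := fun ω => ENNReal.ofReal (hhG.mk h ω) * ENNReal.ofReal (k ω * f ω))
        (fun ω => ENNReal.ofReal (1 - hhG.mk h ω) * ENNReal.ofReal (k ω * g ω))
        ((hH.mono hG le_rfl).aemeasurable.mul hXf),
      condLExp_mul_left hG hH hXf, condLExp_mul_left hG hH' hXg, hf' k hk, hg' k hk, hh0, hh1,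
      hhG.ae_eq_mk] with ω a1 a2 a3 a4 a5 a6 c d m
    rw [a1, a2, Pi.add_apply, a3, a4, ← m]
    calc _ ≤ ENNReal.ofReal (h ω) * 1 + ENNReal.ofReal (1 - h ω) * 1 := by gcongr
      _ = 1 := by
        rw [mul_one, mul_one, ← ENNReal.ofReal_add c (sub_nonneg.2 d)]
        simp

theorem isSolidSet_condPolar {C : Set (Ω →ₘ[P] ℝ)} (hC : C ⊆ L0plus P) :
    IsSolidSet P (condPolar G P C) := by
  rintro f ⟨-, hf⟩ g hg hgf
  refine ⟨hg, fun k hk => ?_⟩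
  have hle : (fun ω => ENNReal.ofReal (k ω * g ω)) ≤ᵐ[P] fun ω => ENNReal.ofReal (k ω * f ω) := by
    filter_upwards [mem_L0plus_iff.1 (hC hk), AEEqFun.coeFn_le.2 hgf] with ω a b
    exact ENNReal.ofReal_le_ofReal (mul_le_mul_of_nonneg_left b a)
  filter_upwards [condLExp_mono (mΩ := G) hle, hf k hk] with ω a b using a.trans b

/-- Fatou's lemma, applied on each `G`-measurable set. -/
theorem isClosedInProb_condPolar (hG : G ≤ F) [IsFiniteMeasure P] (C : Set (Ω →ₘ[P] ℝ)) :
    IsClosedInProb P (condPolar G P C) := by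
  rw [isClosedInProb_iff_seq]
  intro u f hu hlim
  obtain ⟨ns, -, hns⟩ := hlim.exists_seq_tendsto_ae
  refine ⟨mem_L0plus_iff.2 ?_, fun k hk => (condLExp_le_one_iff hG).2 fun s hs => ?_⟩
  · filter_upwards [hns, ae_all_iff.2 fun n => mem_L0plus_iff.1 (hu n).1] with ω h1 h2
    exact ge_of_tendsto' h1 fun n => h2 _
  · calc ∫⁻ ω in s, ENNReal.ofReal (k ω * f ω) ∂P
        = ∫⁻ ω in s, liminf (fun n => ENNReal.ofReal (k ω * u (ns n) ω)) atTop ∂P := by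
          refine lintegral_congr_ae (ae_restrict_of_ae ?_)
          filter_upwards [hns] with ω h1
          exact (ENNReal.tendsto_ofReal (h1.const_mul (k ω))).liminf_eq.symm
      _ ≤ liminf (fun n => ∫⁻ ω in s, ENNReal.ofReal (k ω * u (ns n) ω) ∂P) atTop :=
          lintegral_liminf_le' fun n => (aemeasurable_ofReal_mul k (u (ns n))).restrict
      _ ≤ P s := liminf_le_of_le (by isBoundedDefault) fun b hb => by
          obtain ⟨n, hn⟩ := hb.exists
          exact hn.trans ((condLExp_le_one_iff hG).1 ((hu (ns n)).2 k hk) s hs)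

theorem condPolar_subset (C : Set (Ω →ₘ[P] ℝ)) : condPolar G P C ⊆ L0plus P := fun _ h => h.1

theorem subset_condBipolar {C : Set (Ω →ₘ[P] ℝ)} (hC : C ⊆ L0plus P) :
    C ⊆ condBipolar G P C := by
  refine fun f hf => ⟨hC hf, fun g hg => ?_⟩
  simpa only [mul_comm] using hg.2 f hf

/-! ### Essential suprema of upward directed families -/

/-- A family directed upward almost everywhere, with integrals bounded by `α < ∞`, has a countable
subfamily whose supremum is an almost everywhere upper bound of the family and has integral at most
`α`. -/
theorem exists_seq_iSup_ae_upper_bound {S : Set (Ω → ℝ≥0∞)} (hne : S.Nonempty)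
    (hmeas : ∀ Y ∈ S, AEMeasurable Y P)
    (hdir : ∀ Y ∈ S, ∀ Z ∈ S, ∃ W ∈ S, Y ≤ᵐ[P] W ∧ Z ≤ᵐ[P] W)
    {α : ℝ≥0∞} (hα : α ≠ ∞) (hint : ∀ Y ∈ S, ∫⁻ ω, Y ω ∂P ≤ α) :
    ∃ X : ℕ → Ω → ℝ≥0∞, (∀ n, X n ∈ S) ∧ ∫⁻ ω, ⨆ n, X n ω ∂P ≤ α ∧
      ∀ Y ∈ S, ∀ᵐ ω ∂P, Y ω ≤ ⨆ n, X n ω := by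
  set I : Set ℝ≥0∞ := (fun Y : Ω → ℝ≥0∞ => ∫⁻ ω, Y ω ∂P) '' S
  -- By directedness, countable suprema do not increase the supremum of the integrals.
  have key : ∀ X : ℕ → Ω → ℝ≥0∞, (∀ n, X n ∈ S) → ∫⁻ ω, ⨆ n, X n ω ∂P ≤ sSup I := by
    intro X hX
    choose! W hWS hW1 hW2 using hdir
    let Z : ℕ → Ω → ℝ≥0∞ := fun n => Nat.rec (X 0) (fun n z => W z (X (n + 1))) n
    have hZS : ∀ n, Z n ∈ S := by
      intro n
      induction n with
      | zero => exact hX 0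
      | succ n ih => exact hWS _ ih _ (hX _)
    have hmono : ∀ᵐ ω ∂P, Monotone fun n => Z n ω := by
      filter_upwards [ae_all_iff.2 fun n => hW1 _ (hZS n) _ (hX (n + 1))] with ω h
      exact monotone_nat_of_le_succ h
    have hXZ : ∀ᵐ ω ∂P, ∀ n, X n ω ≤ Z n ω := by
      refine ae_all_iff.2 fun n => ?_
      cases n with
      | zero => exact ae_of_all _ fun ω => le_rfl
      | succ n => exact hW2 _ (hZS n) _ (hX (n + 1))
    calc ∫⁻ ω, ⨆ n, X n ω ∂P ≤ ∫⁻ ω, ⨆ n, Z n ω ∂P :=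
          lintegral_mono_ae (hXZ.mono fun ω h => iSup_mono h)
      _ = ⨆ n, ∫⁻ ω, Z n ω ∂P := lintegral_iSup' (fun n => hmeas _ (hZS n)) hmono
      _ ≤ sSup I := iSup_le fun n => le_sSup ⟨_, hZS n, rfl⟩
  obtain ⟨u, -, hu, huI⟩ := exists_seq_tendsto_sSup (hne.image _ : I.Nonempty) (OrderTop.bddAbove I)
  choose X hXS hXu using huI
  have hIα : sSup I ≤ α := sSup_le (by rintro _ ⟨Y, hY, rfl⟩; exact hint Y hY)
  have hle : sSup I ≤ ∫⁻ ω, ⨆ n, X n ω ∂P :=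
    le_of_tendsto' hu fun n => by
      rw [← hXu n]
      exact lintegral_mono fun ω => le_iSup (fun n => X n ω) n
  refine ⟨X, hXS, (key X hXS).trans hIα, fun Y hY => ?_⟩
  -- Adjoining `Y` to the maximizing sequence leaves the finite integral of the supremum unchanged.
  let V : ℕ → Ω → ℝ≥0∞ := fun n => Nat.casesOn n Y X
  have hVS : ∀ n, V n ∈ S := by
    intro n
    cases n with
    | zero => exact hY
    | succ n => exact hXS n
  have hXV : ∀ ω, ⨆ n, X n ω ≤ ⨆ n, V n ω := fun ω =>
    iSup_le fun n => le_iSup (fun n => V n ω) (n + 1)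
  have heq := ae_eq_of_ae_le_of_lintegral_le (ae_of_all P hXV)
    (((key X hXS).trans hIα).trans_lt hα.lt_top).ne
    (AEMeasurable.iSup fun n => hmeas _ (hVS n)) ((key V hVS).trans hle)
  filter_upwards [heq] with ω h
  rw [h]
  exact le_iSup (fun n => V n ω) 0

/-! ### Solid sets: truncation and separation in `L²` -/

/-- The truncation `f ∧ n` of a random variable. -/
def trunc (f : Ω →ₘ[P] ℝ) (n : ℕ) : Ω →ₘ[P] ℝ := f ⊓ AEEqFun.const Ω (n : ℝ)

theorem coeFn_trunc (f : Ω →ₘ[P] ℝ) (n : ℕ) : ∀ᵐ ω ∂P, trunc f n ω = min (f ω) n := by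
  filter_upwards [AEEqFun.coeFn_inf f (AEEqFun.const Ω (n : ℝ)),
    AEEqFun.coeFn_const Ω (μ := P) (n : ℝ)] with ω h1 h2
  rw [trunc, h1, h2]
  rfl

theorem trunc_le (f : Ω →ₘ[P] ℝ) (n : ℕ) : trunc f n ≤ f := AEEqFun.inf_le_left _ _

theorem trunc_mem_L0plus {f : Ω →ₘ[P] ℝ} (hf : f ∈ L0plus P) (n : ℕ) : trunc f n ∈ L0plus P := by
  refine mem_L0plus_iff.2 ?_
  filter_upwards [mem_L0plus_iff.1 hf, coeFn_trunc f n] with ω h1 h2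
  rw [h2]
  exact le_min h1 n.cast_nonneg

theorem tendsto_trunc (f : Ω →ₘ[P] ℝ) :
    ∀ᵐ ω ∂P, Tendsto (fun n => trunc f n ω) atTop (𝓝 (f ω)) := by
  filter_upwards [ae_all_iff.2 (coeFn_trunc f)] with ω h
  refine tendsto_const_nhds.congr' ?_
  filter_upwards [eventually_ge_atTop ⌈f ω⌉₊] with n hn
  rw [h, min_eq_left ((Nat.le_ceil _).trans (Nat.cast_le.2 hn))]

theorem memLp_of_le_trunc [IsFiniteMeasure P] {f g : Ω →ₘ[P] ℝ} {n : ℕ} (hg : g ∈ L0plus P)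
    (hgf : g ≤ trunc f n) : g ∈ Lp ℝ 2 P := by
  rw [Lp.mem_Lp_iff_memLp]
  refine MemLp.of_bound g.aestronglyMeasurable n ?_
  filter_upwards [mem_L0plus_iff.1 hg, AEEqFun.coeFn_le.2 hgf, coeFn_trunc f n] with ω h1 h2 h3
  rw [Real.norm_of_nonneg h1]
  exact h2.trans (h3.trans_le (min_le_right _ _))

theorem const_mem_L0plusSub {a : ℝ} (ha : 0 ≤ a) :
    (AEEqFun.const Ω a : Ω →ₘ[P] ℝ) ∈ L0plusSub G P := by
  have h := AEEqFun.coeFn_const Ω (μ := P) a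
  exact ⟨mem_L0plus_iff.2 (h.mono fun ω hω => by rw [hω]; exact ha),
    (stronglyMeasurable_const (b := a)).aestronglyMeasurable.congr h.symm⟩

/-- The elements of `D` that are square integrable form a convex subset of `L²`. -/
theorem convex_preimage_Lp {D : Set (Ω →ₘ[P] ℝ)} (hD : IsCondConvex G P D) :
    Convex ℝ {u : Lp ℝ 2 P | (u : Ω →ₘ[P] ℝ) ∈ D} := by
  intro u hu v hv a b ha hb hab
  have hc := AEEqFun.coeFn_const Ω (μ := P) a
  have h1 : (AEEqFun.const Ω a : Ω →ₘ[P] ℝ) ≤ 1 := by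
    rw [← AEEqFun.coeFn_le]
    filter_upwards [hc, AEEqFun.coeFn_one (μ := P) (β := ℝ)] with ω h1 h2
    rw [h1, h2]
    exact (le_add_of_nonneg_right hb).trans_eq hab
  have h := hD _ hu _ hv _ (const_mem_L0plusSub ha) h1
  change ((a • u + b • v : Lp ℝ 2 P) : Ω →ₘ[P] ℝ) ∈ D
  convert! h using 1
  refine AEEqFun.ext ?_
  filter_upwards [coeFn_condConvex_comb (AEEqFun.const Ω a) u.1 v.1, hc,
    Lp.coeFn_add (a • u) (b • v), Lp.coeFn_smul a u, Lp.coeFn_smul b v] with ω e1 e2 e3 e4 e5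
  rw [e1, e2, e3, Pi.add_apply, e4, e5, ← hab]
  simp

theorem isClosed_preimage_Lp {D : Set (Ω →ₘ[P] ℝ)} (hD : IsClosedInProb P D) :
    IsClosed {u : Lp ℝ 2 P | (u : Ω →ₘ[P] ℝ) ∈ D} :=
  IsSeqClosed.isClosed fun _ _ hu hlim =>
    (isClosedInProb_iff_seq P D).1 hD _ _ hu (tendstoInMeasure_of_tendsto_Lp hlim)

/-- Separation without conditioning. Truncation makes `D ∩ L²` large enough in `D` that a
separating functional on `L²`, whose density can be taken nonnegative because `D` is solid,
remains bounded on all of `D`. -/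
theorem exists_separating_density [IsFiniteMeasure P] {D : Set (Ω →ₘ[P] ℝ)}
    (hD0 : D ⊆ L0plus P) (hne : D.Nonempty) (hconv : IsCondConvex G P D) (hsolid : IsSolidSet P D)
    (hclosed : IsClosedInProb P D) {f₀ : Ω →ₘ[P] ℝ} (hf₀ : f₀ ∈ L0plus P) (hf₀D : f₀ ∉ D) :
    ∃ g ∈ L0plus P, ∃ α : ℝ≥0∞, (∀ f ∈ D, ∫⁻ ω, ENNReal.ofReal (f ω * g ω) ∂P ≤ α) ∧
      α < ∫⁻ ω, ENNReal.ofReal (f₀ ω * g ω) ∂P := by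
  obtain ⟨n, hn⟩ : ∃ n, trunc f₀ n ∉ D := by
    by_contra! h
    exact hf₀D ((isClosedInProb_iff_seq P D).1 hclosed _ _ h (tendstoInMeasure_of_tendsto_ae
      (fun n => (trunc f₀ n).aestronglyMeasurable) (tendsto_trunc f₀)))
  let x : Lp ℝ 2 P := ⟨trunc f₀ n, memLp_of_le_trunc (trunc_mem_L0plus hf₀ n) le_rfl⟩
  obtain ⟨l, c, hlD, hlx⟩ := geometric_hahn_banach_closed_point (x := x)
    (convex_preimage_Lp hconv) (isClosed_preimage_Lp hclosed) hn
  let w : Lp ℝ 2 P := (InnerProductSpace.toDual ℝ (Lp ℝ 2 P)).symm l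
  have hlw : ∀ v : Lp ℝ 2 P, Integrable (fun ω => v ω * w ω) P ∧ l v = ∫ ω, v ω * w ω ∂P := by
    intro v
    have h1 : l v = inner ℝ w v := (InnerProductSpace.toDual_symm_apply).symm
    exact ⟨L2.integrable_inner w v, h1.trans (L2.inner_def w v)⟩
  let g : Ω →ₘ[P] ℝ := AEEqFun.posPart w.1
  have hg : ∀ᵐ ω ∂P, g ω = max (w ω) 0 := AEEqFun.coeFn_posPart w.1
  have hgL : g ∈ L0plus P := mem_L0plus_iff.2 (hg.mono fun ω h => h ▸ le_max_right _ _)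
  have hc0 : 0 < c := by
    obtain ⟨f, hf⟩ := hne
    have h0 : ((0 : Lp ℝ 2 P) : Ω →ₘ[P] ℝ) ∈ D := hsolid f hf 0 (le_refl (0 : Ω →ₘ[P] ℝ)) (hD0 hf)
    simpa using hlD 0 h0
  refine ⟨g, hgL, ENNReal.ofReal c, fun f hf => ?_, ?_⟩
  · have htrunc : ∀ m, ∫⁻ ω, ENNReal.ofReal (trunc f m ω * g ω) ∂P ≤ ENNReal.ofReal c := by
      intro m
      have hfm0 := mem_L0plus_iff.1 (trunc_mem_L0plus (hD0 hf) m)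
      -- Restricting `f ∧ m` to the set where `w` is positive turns `w` into its positive part.
      have hA : MeasurableSet {ω | 0 < w ω} :=
        measurableSet_lt measurable_const w.1.measurable
      let t : Ω →ₘ[P] ℝ := AEEqFun.mk ({ω | 0 < w ω}.indicator (trunc f m))
        ((trunc f m).aestronglyMeasurable.indicator hA)
      have ht : ∀ᵐ ω ∂P, t ω = {ω | 0 < w ω}.indicator (trunc f m) ω := AEEqFun.coeFn_mk _ _
      have ht0 : t ∈ L0plus P := by
        refine mem_L0plus_iff.2 ?_
        filter_upwards [ht, hfm0] with ω h1 h2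
        rw [h1]
        exact Set.indicator_apply_nonneg fun _ => h2
      have htle : t ≤ trunc f m := by
        rw [← AEEqFun.coeFn_le]
        filter_upwards [ht, hfm0] with ω h1 h2
        rw [h1]
        exact Set.indicator_apply_le' (fun _ => le_rfl) fun _ => h2
      let t' : Lp ℝ 2 P := ⟨t, memLp_of_le_trunc ht0 htle⟩
      have htg : (fun ω => trunc f m ω * g ω) =ᵐ[P] fun ω => t' ω * w ω := by
        filter_upwards [ht, hg] with ω h1 h2
        change _ = t ω * w ω
        rw [h1, h2]
        by_cases hw : 0 < w ω
        · rw [max_eq_left hw.le, Set.indicator_of_mem (by exact hw)]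
        · rw [max_eq_right (not_lt.1 hw), Set.indicator_of_notMem (by exact hw), mul_zero, zero_mul]
      have hint : Integrable (fun ω => trunc f m ω * g ω) P := (hlw t').1.congr htg.symm
      rw [← ofReal_integral_eq_lintegral_ofReal hint, integral_congr_ae htg, ← (hlw t').2]
      · exact ENNReal.ofReal_le_ofReal
          (hlD t' (hsolid f hf t ht0 (htle.trans (trunc_le f m)))).le
      · filter_upwards [hfm0, mem_L0plus_iff.1 hgL] with ω h1 h2 using mul_nonneg h1 h2
    calc ∫⁻ ω, ENNReal.ofReal (f ω * g ω) ∂P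
        = ∫⁻ ω, liminf (fun m => ENNReal.ofReal (trunc f m ω * g ω)) atTop ∂P := by
          refine lintegral_congr_ae ?_
          filter_upwards [tendsto_trunc f] with ω h1
          exact (ENNReal.tendsto_ofReal (h1.mul_const (g ω))).liminf_eq.symm
      _ ≤ liminf (fun m => ∫⁻ ω, ENNReal.ofReal (trunc f m ω * g ω) ∂P) atTop :=
          lintegral_liminf_le' fun m => aemeasurable_ofReal_mul (trunc f m) g
      _ ≤ ENNReal.ofReal c := liminf_le_of_le (by isBoundedDefault) fun b hb => by
          obtain ⟨m, hm⟩ := hb.exists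
          exact hm.trans (htrunc m)
  · have hx0 := mem_L0plus_iff.1 (trunc_mem_L0plus hf₀ n)
    calc ENNReal.ofReal c < ENNReal.ofReal (l x) :=
          (ENNReal.ofReal_lt_ofReal_iff (hc0.trans hlx)).2 hlx
      _ = ENNReal.ofReal (∫ ω, x ω * w ω ∂P) := by rw [(hlw x).2]
      _ ≤ ∫⁻ ω, ENNReal.ofReal (x ω * w ω) ∂P := by
          rw [integral_eq_lintegral_pos_part_sub_lintegral_neg_part (hlw x).1]
          exact (ENNReal.ofReal_le_ofReal (sub_le_self _ ENNReal.toReal_nonneg)).trans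
            ENNReal.ofReal_toReal_le
      _ ≤ ∫⁻ ω, ENNReal.ofReal (f₀ ω * g ω) ∂P := by
          refine lintegral_mono_ae ?_
          filter_upwards [hx0, AEEqFun.coeFn_le.2 (trunc_le f₀ n), hg] with ω h1 h2 h3
          refine ENNReal.ofReal_le_ofReal ?_
          rw [h3]
          calc x ω * w ω ≤ x ω * max (w ω) 0 := mul_le_mul_of_nonneg_left (le_max_left _ _) h1
            _ ≤ f₀ ω * max (w ω) 0 := mul_le_mul_of_nonneg_right h2 (le_max_right _ _)

/-! ### Conditional separation -/

/-- Pasting two elements along the set where one conditional expectation exceeds the other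
makes the family `E[f g | G]`, `f ∈ D`, directed upward. -/
theorem exists_condLExp_ge (hG : G ≤ F) [IsFiniteMeasure P] {D : Set (Ω →ₘ[P] ℝ)}
    (hconv : IsCondConvex G P D) (g : Ω →ₘ[P] ℝ) {f₁ f₂ : Ω →ₘ[P] ℝ} (h₁ : f₁ ∈ D) (h₂ : f₂ ∈ D) :
    ∃ f ∈ D,
      condLExp G P (fun ω => ENNReal.ofReal (f₁ ω * g ω)) ≤ᵐ[P]
        condLExp G P (fun ω => ENNReal.ofReal (f ω * g ω)) ∧
      condLExp G P (fun ω => ENNReal.ofReal (f₂ ω * g ω)) ≤ᵐ[P]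
        condLExp G P (fun ω => ENNReal.ofReal (f ω * g ω)) := by
  set Y₁ := condLExp G P fun ω => ENNReal.ofReal (f₁ ω * g ω)
  set Y₂ := condLExp G P fun ω => ENNReal.ofReal (f₂ ω * g ω)
  -- On `A` the pasted element agrees with `f₁`, off `A` with `f₂`.
  let A : Set Ω := {ω | Y₂ ω ≤ Y₁ ω}
  have hA : MeasurableSet[G] A :=
    measurableSet_le (measurable_condLExp G P _) (measurable_condLExp G P _)
  have hsm : StronglyMeasurable[G] (A.indicator fun _ => (1 : ℝ)) :=
    stronglyMeasurable_const.indicator hA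
  let h : Ω →ₘ[P] ℝ := AEEqFun.mk (A.indicator fun _ => (1 : ℝ)) (hsm.mono hG).aestronglyMeasurable
  have hh : h =ᵐ[P] A.indicator fun _ => (1 : ℝ) := AEEqFun.coeFn_mk _ _
  have hh0 : h ∈ L0plusSub G P := by
    refine ⟨mem_L0plus_iff.2 ?_, hsm.aestronglyMeasurable.congr hh.symm⟩
    filter_upwards [hh] with ω e
    rw [e]
    exact Set.indicator_apply_nonneg fun _ => zero_le_one
  have hh1 : h ≤ 1 := by
    rw [← AEEqFun.coeFn_le]
    filter_upwards [hh, AEEqFun.coeFn_one (μ := P) (β := ℝ)] with ω e e1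
    rw [e, e1]
    exact Set.indicator_apply_le' (fun _ => le_rfl) fun _ => zero_le_one
  have e1 : (fun ω => ENNReal.ofReal ((h * f₁ + (1 - h) * f₂ : Ω →ₘ[P] ℝ) ω * g ω)) =ᵐ[P]
      (fun ω => A.indicator 1 ω * ENNReal.ofReal (f₁ ω * g ω)) +
        fun ω => Aᶜ.indicator 1 ω * ENNReal.ofReal (f₂ ω * g ω) := by
    filter_upwards [coeFn_condConvex_comb h f₁ f₂, hh] with ω e1 e2
    by_cases hω : ω ∈ A <;> simp [e1, e2, hω]
  have hI : Measurable[G] (A.indicator (1 : Ω → ℝ≥0∞)) :=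
    (measurable_const (a := (1 : ℝ≥0∞))).indicator hA
  have hI' : Measurable[G] (Aᶜ.indicator (1 : Ω → ℝ≥0∞)) :=
    (measurable_const (a := (1 : ℝ≥0∞))).indicator hA.compl
  have e2 : ∀ᵐ ω ∂P, condLExp G P
      (fun ω => ENNReal.ofReal ((h * f₁ + (1 - h) * f₂ : Ω →ₘ[P] ℝ) ω * g ω)) ω =
        A.indicator 1 ω * Y₁ ω + Aᶜ.indicator 1 ω * Y₂ ω := by
    filter_upwards [condLExp_congr_ae (mΩ := G) e1,
      condLExp_add_left (mΩ := G)
        (X := fun ω => A.indicator 1 ω * ENNReal.ofReal (f₁ ω * g ω))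
        (fun ω => Aᶜ.indicator 1 ω * ENNReal.ofReal (f₂ ω * g ω))
        ((hI.mono hG le_rfl).aemeasurable.mul (aemeasurable_ofReal_mul f₁ g)),
      condLExp_mul_left hG hI (aemeasurable_ofReal_mul f₁ g),
      condLExp_mul_left hG hI' (aemeasurable_ofReal_mul f₂ g)] with ω a1 a2 a3 a4
    rw [a1, a2, Pi.add_apply, a3, a4]
  refine ⟨_, hconv f₁ h₁ f₂ h₂ h hh0 hh1, ?_, ?_⟩ <;> filter_upwards [e2] with ω e <;> rw [e] <;>
    by_cases hω : ω ∈ A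
  · simp [hω]
  · simpa [hω] using (not_le.1 hω).le
  · simp only [Set.indicator_of_mem hω, Set.indicator_of_notMem (Set.notMem_compl_iff.2 hω),
      Pi.one_apply, one_mul, zero_mul, add_zero]
    exact hω
  · simp [hω]

/-- The bipolar inclusion. If `E[f g] ≤ α < E[f₀ g]` for `f ∈ D`, then
`X = ess sup {E[f g | G] | f ∈ D}` still satisfies `E[X] ≤ α`, so that `g / (X + δ)` lies in the
conditional polar of `D` for every `δ > 0`, and for small `δ` it separates `f₀` from `D`. -/
theorem condBipolar_subset (hG : G ≤ F) [IsProbabilityMeasure P] {D : Set (Ω →ₘ[P] ℝ)}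
    (hD0 : D ⊆ L0plus P) (hne : D.Nonempty) (hconv : IsCondConvex G P D) (hsolid : IsSolidSet P D)
    (hclosed : IsClosedInProb P D) : condBipolar G P D ⊆ D := by
  rintro f₀ ⟨hf₀, hpol⟩
  by_contra hf₀D
  obtain ⟨g, hg, α, hα, hαlt⟩ :=
    exists_separating_density hD0 hne hconv hsolid hclosed hf₀ hf₀D
  let E : (Ω →ₘ[P] ℝ) → Ω → ℝ≥0∞ := fun f => condLExp G P fun ω => ENNReal.ofReal (f ω * g ω)
  obtain ⟨Y, hYS, hYint, hYub⟩ := exists_seq_iSup_ae_upper_bound (P := P) (S := E '' D)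
    (hne.image _)
    (by rintro _ ⟨f, -, rfl⟩; exact (measurable_condLExp' G P _).aemeasurable)
    (by
      rintro _ ⟨f₁, h₁, rfl⟩ _ ⟨f₂, h₂, rfl⟩
      obtain ⟨f, hf, hf1, hf2⟩ := exists_condLExp_ge hG hconv g h₁ h₂
      exact ⟨_, ⟨f, hf, rfl⟩, hf1, hf2⟩)
    (hαlt.trans_le le_top).ne
    (by rintro _ ⟨f, hf, rfl⟩; exact (lintegral_condLExp hG P _).trans_le (hα f hf))
  obtain ⟨β, hαβ, hβ⟩ := exists_between hαlt
  let δ : ℝ≥0∞ := β - α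
  have hδ0 : δ ≠ 0 := (tsub_pos_of_lt hαβ).ne'
  let k : Ω → ℝ≥0∞ := fun ω => ((⨆ n, Y n ω) + δ)⁻¹
  have hk : Measurable[G] k := by
    refine Measurable.inv (Measurable.add_const (Measurable.iSup fun n => ?_) δ)
    obtain ⟨f, -, hf⟩ := hYS n
    rw [← hf]
    exact measurable_condLExp G P _
  -- The constant `δ > 0` keeps `k` finite even where the supremum vanishes.
  have hktop : ∀ ω, k ω ≠ ∞ := fun ω => by simp [k, hδ0]
  have hkF : Measurable[F] k := hk.mono hG le_rfl
  let g' : Ω →ₘ[P] ℝ := AEEqFun.mk (fun ω => (k ω).toReal * g ω)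
    (hkF.ennreal_toReal.mul g.measurable).aestronglyMeasurable
  have hg' : ∀ᵐ ω ∂P, g' ω = (k ω).toReal * g ω := AEEqFun.coeFn_mk _ _
  have hg'E : ∀ f : Ω →ₘ[P] ℝ, ∀ᵐ ω ∂P,
      condLExp G P (fun ω => ENNReal.ofReal (f ω * g' ω)) ω = k ω * E f ω := by
    intro f
    have e : (fun ω => ENNReal.ofReal (f ω * g' ω)) =ᵐ[P]
        fun ω => k ω * ENNReal.ofReal (f ω * g ω) := by
      filter_upwards [hg'] with ω h
      rw [h, mul_left_comm, ENNReal.ofReal_mul ENNReal.toReal_nonneg,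
        ENNReal.ofReal_toReal (hktop ω)]
    exact (condLExp_congr_ae e).trans (condLExp_mul_left hG hk (aemeasurable_ofReal_mul f g))
  have hg'pol : g' ∈ condPolar G P D := by
    refine ⟨mem_L0plus_iff.2 ?_, fun f hf => ?_⟩
    · filter_upwards [hg', mem_L0plus_iff.1 hg] with ω h1 h2
      rw [h1]
      exact mul_nonneg ENNReal.toReal_nonneg h2
    · filter_upwards [hg'E f, hYub _ ⟨f, hf, rfl⟩] with ω h1 h2
      rw [h1]
      calc k ω * E f ω ≤ k ω * ((⨆ n, Y n ω) + δ) := by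
            gcongr
            exact h2.trans le_self_add
        _ ≤ 1 := ENNReal.inv_mul_le_one _
  have hle : ∀ᵐ ω ∂P, E f₀ ω ≤ (⨆ n, Y n ω) + δ := by
    have h := hpol g' hg'pol
    simp only [mul_comm (g' _)] at h
    filter_upwards [h, hg'E f₀] with ω h1 h2
    rw [h2] at h1
    rcases eq_or_ne ((⨆ n, Y n ω) + δ) ∞ with h3 | h3
    · exact h3 ▸ le_top
    · rwa [ENNReal.inv_mul_le_iff (by simp [hδ0]) h3, mul_one] at h1
  refine (hβ.trans_le ?_).false
  calc ∫⁻ ω, ENNReal.ofReal (f₀ ω * g ω) ∂P = ∫⁻ ω, E f₀ ω ∂P := (lintegral_condLExp hG P _).symm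
    _ ≤ ∫⁻ ω, ((⨆ n, Y n ω) + δ) ∂P := lintegral_mono_ae hle
    _ = ∫⁻ ω, (⨆ n, Y n ω) ∂P + δ := by
        rw [lintegral_add_right _ measurable_const, lintegral_const, measure_univ, mul_one]
    _ ≤ α + δ := by gcongr
    _ = β := add_tsub_cancel_of_le hαβ.le

theorem condPolar_anti {C D : Set (Ω →ₘ[P] ℝ)} (h : C ⊆ D) :
    condPolar G P D ⊆ condPolar G P C :=
  fun _ hg => ⟨hg.1, fun f hf => hg.2 f (h hf)⟩

end CondBipolar

theorem mainTheorem2 {Ω : Type*} (G : MeasurableSpace Ω) [F : MeasurableSpace Ω] (hG : G ≤ F)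
    (P : Measure Ω) [IsProbabilityMeasure P] (C : Set (Ω →ₘ[P] ℝ))
    (hC : C ⊆ CondBipolar.L0plus P) (hne : C.Nonempty)
    (hbdd : CondBipolar.IsBoundedInProb P C) :
    IsLeast {D : Set (Ω →ₘ[P] ℝ) | D ⊆ CondBipolar.L0plus P ∧
        CondBipolar.IsCondConvex G P D ∧ CondBipolar.IsSolidSet P D ∧
        CondBipolar.IsClosedInProb P D ∧ C ⊆ D}
      (CondBipolar.condBipolar G P C) := by
  have hpol := CondBipolar.condPolar_subset (G := G) C
  refine ⟨⟨CondBipolar.condPolar_subset _, CondBipolar.isCondConvex_condPolar hG hpol,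
    CondBipolar.isSolidSet_condPolar hpol, CondBipolar.isClosedInProb_condPolar hG _,
    CondBipolar.subset_condBipolar hC⟩, ?_⟩
  rintro D ⟨hD0, hconv, hsolid, hclosed, hCD⟩
  exact (CondBipolar.condPolar_anti (CondBipolar.condPolar_anti hCD)).trans
    (CondBipolar.condBipolar_subset hG hD0 (hne.mono hCD) hconv hsolid hclosed)
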